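/- Let $n$ be an odd positive integer. For a profile $x=(x_1,\dots,x_n)\in(\mathbb{R}^2)^n$ of agents' locations and a point $y\in\mathbb{R}^2$ let $sc(y,x)=\sum_{i=1}^n\|y-x_i\|$, where $\|\cdot\|$ is the Euclidean norm. Let $c(x)$ be the coordinate-wise median of $x$, that is, the point whose first (second) coordinate is the median of the first (second) coordinates of $x_1,\dots,x_n$, and let $g(x)$ be the geometric median of $x$, a point of $\mathbb{R}^2$ that minimizes $y\mapsto sc(y,x)$. Let $$AR(x)=\frac{sc(c(x),x)}{sc(g(x),x)},$$ where the ratio is read as $1$ if $sc(g(x),x)=0$, i.e. if all agents are at the same point (then $c(x)=g(x)$). Then the worst-case approximation ratio of the coordinate-wise median mechanism is $$\sup_{x\in(\mathbb{R}^2)^n}AR(x)=\sqrt{2}\,\frac{\sqrt{n^2+1}}{n+1}.$$ Moreover, if $n=2m+1$ with $m\ge 1$, then the supremum is attained at the profile with $x_1=\dots=x_m=\left(\frac{m+1}{m},0\right)$, $x_{m+1}=\left(-\frac{m+1}{m},0\right)$ and $x_{m+2}=\dots=x_{2m+1}=(0,1)$. -/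

import Mathlib

/-- The plane `ℝ²` with the Euclidean norm. -/
abbrev Plane : Type := EuclideanSpace ℝ (Fin 2)

/-- The social cost `∑ᵢ ‖y - xᵢ‖` of the location `y` at the profile `x`. -/
noncomputable def socialCost {n : ℕ} (y : Plane) (x : Fin n → Plane) : ℝ :=
  ∑ i, ‖y - x i‖

/-- The median of an odd number of reals: the middle entry after sorting. -/
noncomputable def oddMedian {n : ℕ} (hn : Odd n) (a : Fin n → ℝ) : ℝ :=
  a (Tuple.sort a ⟨n / 2, Nat.div_lt_self hn.pos one_lt_two⟩)

/-- The coordinate-wise median mechanism. -/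
noncomputable def coordMedian {n : ℕ} (hn : Odd n) (x : Fin n → Plane) : Plane :=
  !₂[oddMedian hn (fun i => x i 0), oddMedian hn (fun i => x i 1)]

/-- `y` is a geometric median of `x`: it minimizes the social cost over the whole plane. -/
def IsGeometricMedian {n : ℕ} (y : Plane) (x : Fin n → Plane) : Prop :=
  ∀ z : Plane, socialCost y x ≤ socialCost z x

theorem exists_isGeometricMedian {n : ℕ} (hn : Odd n) (x : Fin n → Plane) :
    ∃ y : Plane, IsGeometricMedian y x := by
  have hc : Continuous (fun y : Plane => socialCost y x) := by
    unfold socialCost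
    fun_prop
  let i₀ : Fin n := ⟨0, hn.pos⟩
  have ht : Filter.Tendsto (fun y : Plane => socialCost y x)
      (Filter.cocompact Plane) Filter.atTop := by
    have h1 : Filter.Tendsto (fun y : Plane => ‖y‖ - ‖x i₀‖)
        (Filter.cocompact Plane) Filter.atTop := by
      simpa [sub_eq_add_neg] using
        Filter.tendsto_atTop_add_const_right _ (-‖x i₀‖) (tendsto_norm_cocompact_atTop (E := Plane))
    refine Filter.tendsto_atTop_mono (fun y => ?_) h1
    refine (norm_sub_norm_le y (x i₀)).trans ?_
    exact Finset.single_le_sum (f := fun i => ‖y - x i‖) (fun i _ => norm_nonneg _)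
      (Finset.mem_univ i₀)
  exact hc.exists_forall_le ht

/-- The geometric median mechanism. -/
noncomputable def geomMedian {n : ℕ} (hn : Odd n) (x : Fin n → Plane) : Plane :=
  Classical.choose (exists_isGeometricMedian hn x)

theorem geomMedian_spec {n : ℕ} (hn : Odd n) (x : Fin n → Plane) :
    IsGeometricMedian (geomMedian hn x) x :=
  Classical.choose_spec (exists_isGeometricMedian hn x)

open Classical in
/-- The approximation ratio `sc(c(x), x) / sc(g(x), x)` of the coordinate-wise median at the
profile `x`. If the optimal cost is `0`, then all agents are at the same point, the coordinate-wise
median is that point too, and the ratio `0 / 0` is read as `1`. -/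
noncomputable def approxRatio {n : ℕ} (hn : Odd n) (x : Fin n → Plane) : ℝ :=
  if socialCost (geomMedian hn x) x = 0 then 1
  else socialCost (coordMedian hn x) x / socialCost (geomMedian hn x) x

/-- The profile whose first `m` agents are at `(t, 0)`, whose next agent is at `(-t, 0)` and whose
remaining agents are at `(0, 1)`. -/
noncomputable def isoscelesProfile (n m : ℕ) (t : ℝ) : Fin n → Plane := fun i =>
  if (i : ℕ) < m then !₂[t, 0] else if (i : ℕ) = m then !₂[-t, 0] else !₂[0, 1]

/-!
Put `k = (n - 1) / (n + 1)`. If every agent gets a weight in `[k, 1]`, then in each coordinate any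
`(n + 1) / 2` agents still carry at least half of the total weight, so the unweighted median `c`
minimizes the weighted sum of distances as well. Every planar vector `p` has weights `b` in
`[k, 1] ^ 2` with `‖b‖ ≤ √(1 + k ^ 2)` and `‖p‖ ≤ b₀ |p₀| + b₁ |p₁|`. Choosing such weights for each
`p = xᵢ - c`, moving from `c` to any point `y` does not decrease the weighted sum, and by
Cauchy-Schwarz the weighted sum at `y` is at most `√(1 + k ^ 2)` times the cost of `y`.

At the isosceles profile the coordinate-wise median is the foot `0` of the altitude, and comparing
it with the apex `(0, 1)` already gives the ratio `√(1 + k ^ 2)`.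
-/

open scoped Finset

section WeightedMedian

variable {ι : Type*}

theorem sum_mul_abs_sub_le_of_le {s : Finset ι} {w a : ι → ℝ} {c t : ℝ} (hw : ∀ i ∈ s, 0 ≤ w i)
    (hbal : ∑ i ∈ s with ¬a i ≤ c, w i ≤ ∑ i ∈ s with a i ≤ c, w i) (hct : c ≤ t) :
    ∑ i ∈ s, w i * |a i - c| ≤ ∑ i ∈ s, w i * |a i - t| := by
  have hpoint : ∀ i ∈ s,
      w i * |a i - c| + (if a i ≤ c then w i else -w i) * (t - c) ≤ w i * |a i - t| := by
    intro i hi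
    split_ifs with hac
    · rw [abs_of_nonpos (sub_nonpos.2 hac), abs_of_nonpos (sub_nonpos.2 (hac.trans hct))]
      linarith
    · have htri := abs_sub_le (a i) t c
      rw [abs_of_nonneg (sub_nonneg.2 hct)] at htri
      linarith [mul_le_mul_of_nonneg_left htri (hw i hi)]
  have hshift : 0 ≤ (∑ i ∈ s, if a i ≤ c then w i else -w i) * (t - c) := by
    refine mul_nonneg ?_ (sub_nonneg.2 hct)
    rw [Finset.sum_ite, Finset.sum_neg_distrib]
    linarith
  have hsum := Finset.sum_le_sum hpoint
  rw [Finset.sum_add_distrib, ← Finset.sum_mul] at hsum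
  linarith

theorem sum_mul_abs_sub_le_of_balanced {s : Finset ι} {w a : ι → ℝ} {c : ℝ} (hw : ∀ i ∈ s, 0 ≤ w i)
    (hle : ∑ i ∈ s with ¬a i ≤ c, w i ≤ ∑ i ∈ s with a i ≤ c, w i)
    (hge : ∑ i ∈ s with ¬c ≤ a i, w i ≤ ∑ i ∈ s with c ≤ a i, w i) (t : ℝ) :
    ∑ i ∈ s, w i * |a i - c| ≤ ∑ i ∈ s, w i * |a i - t| := by
  rcases le_total c t with hct | htc
  · exact sum_mul_abs_sub_le_of_le hw hle hct
  · have hneg := sum_mul_abs_sub_le_of_le (a := -a) (c := -c) (t := -t) hw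
      (by simpa only [Pi.neg_apply, neg_le_neg_iff] using hge) (neg_le_neg htc)
    simpa only [Pi.neg_apply, neg_sub_neg, abs_sub_comm c, abs_sub_comm t] using hneg

/-- The weight `(n - 1) / (n + 1)`: if `n` weights lie between it and `1`, then every strict
majority of the indices carries at least half of the total weight. For odd `n` it is the least such
bound, since `(n + 1) / 2` of these weights balance `(n - 1) / 2` unit weights. -/
noncomputable def majorityWeight (n : ℕ) : ℝ := ((n : ℝ) - 1) / ((n : ℝ) + 1)

theorem majorityWeight_nonneg {n : ℕ} (hn : 0 < n) : 0 ≤ majorityWeight n :=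
  div_nonneg (sub_nonneg.2 (by exact_mod_cast hn)) (by positivity)

theorem majorityWeight_le_one (n : ℕ) : majorityWeight n ≤ 1 :=
  (div_le_one (by positivity)).2 (by linarith)

theorem majorityWeight_two_mul_add_one (m : ℕ) :
    majorityWeight (2 * m + 1) = (m : ℝ) / ((m : ℝ) + 1) := by
  unfold majorityWeight
  push_cast
  field_simp
  ring

theorem sqrt_one_add_majorityWeight_sq (n : ℕ) :
    √(1 + majorityWeight n ^ 2) = √2 * (√((n : ℝ) ^ 2 + 1) / ((n : ℝ) + 1)) := by
  have hn : (0 : ℝ) < (n : ℝ) + 1 := by positivity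
  rw [← mul_div_assoc, ← Real.sqrt_mul zero_le_two, eq_div_iff hn.ne']
  rw [← Real.sqrt_sq hn.le, ← Real.sqrt_mul (by positivity), majorityWeight]
  congr 1
  field_simp
  ring

theorem sum_filter_not_le_sum_filter_of_majority [Fintype ι] {P : ι → Prop} [DecidablePred P]
    {w : ι → ℝ} (hw : ∀ i, w i ∈ Set.Icc (majorityWeight (Fintype.card ι)) 1)
    (hP : Fintype.card ι < 2 * #{i | P i}) :
    ∑ i with ¬P i, w i ≤ ∑ i with P i, w i := by
  set n := Fintype.card ι
  have hcard : #{i | P i} + #{i | ¬P i} = n := by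
    rw [Finset.card_filter_add_card_filter_not, Finset.card_univ]
  have hn : 0 < n := by omega
  have hmaj : (n : ℝ) + 1 ≤ 2 * #{i | P i} := by exact_mod_cast hP
  have hmin : (#{i | ¬P i} : ℝ) ≤ ((n : ℝ) - 1) / 2 := by
    have : (#{i | P i} : ℝ) + #{i | ¬P i} = n := by exact_mod_cast hcard
    linarith
  calc ∑ i with ¬P i, w i ≤ #{i | ¬P i} • (1 : ℝ) :=
        Finset.sum_le_card_nsmul _ _ _ fun i _ => (hw i).2
    _ ≤ ((n : ℝ) - 1) / 2 := by simpa using hmin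
    _ = ((n : ℝ) + 1) / 2 * majorityWeight n := by rw [majorityWeight]; field_simp
    _ ≤ #{i | P i} * majorityWeight n :=
        mul_le_mul_of_nonneg_right (by linarith) (majorityWeight_nonneg hn)
    _ = #{i | P i} • majorityWeight n := (nsmul_eq_mul _ _).symm
    _ ≤ ∑ i with P i, w i := Finset.card_nsmul_le_sum _ _ _ fun i _ => (hw i).1

end WeightedMedian

section OddMedian

variable {n : ℕ}

theorem lt_two_mul_card_le_oddMedian (hn : Odd n) (a : Fin n → ℝ) :
    n < 2 * #{i | a i ≤ oddMedian hn a} := by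
  have hcard : #(Finset.Iic (⟨n / 2, Nat.div_lt_self hn.pos one_lt_two⟩ : Fin n)) ≤
      #{i | a i ≤ oddMedian hn a} :=
    Finset.card_le_card_of_injOn (Tuple.sort a)
      (fun _ hj => (Finset.mem_filter_univ _).2 (Tuple.monotone_sort a (Finset.mem_Iic.1 hj)))
      (Tuple.sort a).injective.injOn
  rw [Fin.card_Iic] at hcard
  dsimp only at hcard
  omega

theorem lt_two_mul_card_oddMedian_le (hn : Odd n) (a : Fin n → ℝ) :
    n < 2 * #{i | oddMedian hn a ≤ a i} := by
  have hcard : #(Finset.Ici (⟨n / 2, Nat.div_lt_self hn.pos one_lt_two⟩ : Fin n)) ≤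
      #{i | oddMedian hn a ≤ a i} :=
    Finset.card_le_card_of_injOn (Tuple.sort a)
      (fun _ hj => (Finset.mem_filter_univ _).2 (Tuple.monotone_sort a (Finset.mem_Ici.1 hj)))
      (Tuple.sort a).injective.injOn
  rw [Fin.card_Ici] at hcard
  dsimp only at hcard
  obtain ⟨m, rfl⟩ := hn
  omega

theorem le_of_card_lt_card_le_add_card_ge {ι α : Type*} [Fintype ι] [LinearOrder α] {a : ι → α}
    {u v : α} (h : Fintype.card ι < #{i | a i ≤ u} + #{i | v ≤ a i}) : v ≤ u := by
  classical
  obtain ⟨i, hi⟩ := Finset.inter_nonempty_of_card_lt_card_add_card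
    (Finset.subset_univ {i | a i ≤ u}) (Finset.subset_univ {i | v ≤ a i}) h
  simp only [Finset.mem_inter, Finset.mem_filter_univ] at hi
  exact hi.2.trans hi.1

theorem oddMedian_eq (hn : Odd n) {a : Fin n → ℝ} {v : ℝ} (hle : n < 2 * #{i | a i ≤ v})
    (hge : n < 2 * #{i | v ≤ a i}) : oddMedian hn a = v := by
  have hle' := lt_two_mul_card_le_oddMedian hn a
  have hge' := lt_two_mul_card_oddMedian_le hn a
  apply le_antisymm <;>
    exact le_of_card_lt_card_le_add_card_ge (a := a) (by rw [Fintype.card_fin]; omega)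

theorem sum_mul_abs_sub_oddMedian_le (hn : Odd n) {w : Fin n → ℝ}
    (hw : ∀ i, w i ∈ Set.Icc (majorityWeight n) 1) (a : Fin n → ℝ) (t : ℝ) :
    ∑ i, w i * |a i - oddMedian hn a| ≤ ∑ i, w i * |a i - t| := by
  have hw' : ∀ i, w i ∈ Set.Icc (majorityWeight (Fintype.card (Fin n))) 1 := by
    rwa [Fintype.card_fin]
  refine sum_mul_abs_sub_le_of_balanced (fun i _ => (majorityWeight_nonneg hn.pos).trans (hw i).1)
    (sum_filter_not_le_sum_filter_of_majority hw' ?_)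
    (sum_filter_not_le_sum_filter_of_majority hw' ?_) t
  · simpa only [Fintype.card_fin] using lt_two_mul_card_le_oddMedian hn a
  · simpa only [Fintype.card_fin] using lt_two_mul_card_oddMedian_le hn a

end OddMedian

section NormWeights

theorem sum_mul_abs_le_norm_mul_norm {ι : Type*} [Fintype ι] (b p : EuclideanSpace ℝ ι) :
    ∑ j, b j * |p j| ≤ ‖b‖ * ‖p‖ := by
  simpa only [EuclideanSpace.norm_eq, Real.norm_eq_abs, sq_abs] using
    Real.sum_mul_le_sqrt_mul_sqrt Finset.univ b (fun j => |p j|)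

theorem le_mul_add_of_sq_eq_add_sq {k r u v : ℝ} (hr : 0 ≤ r) (hu : 0 ≤ u) (hv : 0 ≤ v)
    (h : r ^ 2 = u ^ 2 + v ^ 2) (huk : u ≤ k * r) : r ≤ k * u + v := by
  rcases hr.eq_or_lt with rfl | hr
  · have hu0 : u = 0 := by nlinarith
    simpa [hu0] using hv
  have hvr : v ≤ r := le_of_sq_le_sq (by nlinarith [sq_nonneg u]) hr.le
  refine le_of_mul_le_mul_left ?_ hr
  calc r * r = u * u + v * v := by linarith
    _ ≤ k * r * u + r * v := by gcongr
    _ = r * (k * u + v) := by ring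

theorem plane_norm_sq (p : Plane) : ‖p‖ ^ 2 = |p 0| ^ 2 + |p 1| ^ 2 := by
  simp [EuclideanSpace.norm_sq_eq, Fin.sum_univ_two]

theorem exists_weights_norm_le_sum_mul_abs {k : ℝ} (hk : k ≤ 1) (p : Plane) :
    ∃ b : Plane, (∀ j, b j ∈ Set.Icc k 1) ∧ ‖b‖ ≤ √(1 + k ^ 2) ∧ ‖p‖ ≤ ∑ j, b j * |p j| := by
  -- The unit vector `|p| / ‖p‖` pairs to `‖p‖` with `|p|`; when one of its entries is below `k`,
  -- replacing it by `k` and the other entry by `1` does not decrease the pairing.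
  by_cases! h0 : |p 0| ≤ k * ‖p‖
  · refine ⟨!₂[k, 1], by simp [Fin.forall_fin_two, hk],
      by simp [EuclideanSpace.norm_eq, add_comm], ?_⟩
    simpa using le_mul_add_of_sq_eq_add_sq (norm_nonneg p) (abs_nonneg _) (abs_nonneg _)
      (plane_norm_sq p) h0
  by_cases! h1 : |p 1| ≤ k * ‖p‖
  · refine ⟨!₂[1, k], by simp [Fin.forall_fin_two, hk], by simp [EuclideanSpace.norm_eq], ?_⟩
    simpa [add_comm] using le_mul_add_of_sq_eq_add_sq (norm_nonneg p) (abs_nonneg _) (abs_nonneg _)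
      ((plane_norm_sq p).trans (add_comm _ _)) h1
  have hp : 0 < ‖p‖ := norm_pos_iff.2 fun hp => by simp [hp] at h0
  have hsq : ∑ j, |p j| ^ 2 = ‖p‖ ^ 2 := by rw [plane_norm_sq, Fin.sum_univ_two]
  refine ⟨WithLp.toLp 2 fun j => |p j| / ‖p‖, fun j => ⟨?_, ?_⟩, ?_, ?_⟩
  · exact (le_div_iff₀ hp).2 (by fin_cases j; exacts [h0.le, h1.le])
  · exact (div_le_one hp).2 (PiLp.norm_apply_le p j)
  · have hunit : ‖(WithLp.toLp 2 fun j => |p j| / ‖p‖ : Plane)‖ ^ 2 = 1 := by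
      rw [EuclideanSpace.real_norm_sq_eq]
      simp only [div_pow]
      rw [← Finset.sum_div, hsq, div_self (by positivity)]
    exact Real.le_sqrt_of_sq_le (by rw [hunit]; linarith [sq_nonneg k])
  · simp only [div_mul_eq_mul_div, ← pow_two]
    rw [← Finset.sum_div, hsq, pow_two, mul_div_cancel_right₀ _ hp.ne']

end NormWeights

section UpperBound

variable {n : ℕ}

theorem socialCost_nonneg (y : Plane) (x : Fin n → Plane) : 0 ≤ socialCost y x :=
  Finset.sum_nonneg fun _ _ => norm_nonneg _

theorem coordMedian_apply (hn : Odd n) (x : Fin n → Plane) (j : Fin 2) :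
    coordMedian hn x j = oddMedian hn (fun i => x i j) := by
  fin_cases j <;> rfl

theorem socialCost_coordMedian_le (hn : Odd n) (x : Fin n → Plane) (y : Plane) :
    socialCost (coordMedian hn x) x ≤ √(1 + majorityWeight n ^ 2) * socialCost y x := by
  choose b hb hbnorm hnorm using fun i =>
    exists_weights_norm_le_sum_mul_abs (majorityWeight_le_one n) (x i - coordMedian hn x)
  calc socialCost (coordMedian hn x) x
      = ∑ i, ‖x i - coordMedian hn x‖ := by simp only [socialCost, norm_sub_rev]
    _ ≤ ∑ i, ∑ j, b i j * |x i j - coordMedian hn x j| := Finset.sum_le_sum fun i _ => hnorm i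
    _ = ∑ j, ∑ i, b i j * |x i j - oddMedian hn (fun i => x i j)| := by
        simp only [coordMedian_apply]
        exact Finset.sum_comm
    _ ≤ ∑ j, ∑ i, b i j * |x i j - y j| :=
        Finset.sum_le_sum fun j _ => sum_mul_abs_sub_oddMedian_le hn (fun i => hb i j) _ _
    _ = ∑ i, ∑ j, b i j * |(x i - y) j| := Finset.sum_comm
    _ ≤ ∑ i, √(1 + majorityWeight n ^ 2) * ‖x i - y‖ :=
        Finset.sum_le_sum fun i _ => (sum_mul_abs_le_norm_mul_norm _ _).trans <|
          mul_le_mul_of_nonneg_right (hbnorm i) (norm_nonneg _)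
    _ = √(1 + majorityWeight n ^ 2) * socialCost y x := by
        simp only [socialCost, norm_sub_rev y, Finset.mul_sum]

theorem approxRatio_le (hn : Odd n) (x : Fin n → Plane) :
    approxRatio hn x ≤ √(1 + majorityWeight n ^ 2) := by
  rw [approxRatio]
  split_ifs with hzero
  · exact Real.one_le_sqrt.2 (le_add_of_nonneg_right (sq_nonneg _))
  · exact (div_le_iff₀ ((socialCost_nonneg _ _).lt_of_ne' hzero)).2
      (socialCost_coordMedian_le hn x _)

end UpperBound

section LowerBound

variable {n : ℕ}

theorem one_le_approxRatio (hn : Odd n) (x : Fin n → Plane) : 1 ≤ approxRatio hn x := by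
  rw [approxRatio]
  split_ifs with hzero
  · exact le_rfl
  · exact (one_le_div ((socialCost_nonneg _ _).lt_of_ne' hzero)).2 (geomMedian_spec hn x _)

theorem div_socialCost_le_approxRatio (hn : Odd n) (x : Fin n → Plane) (y : Plane) :
    socialCost (coordMedian hn x) x / socialCost y x ≤ approxRatio hn x := by
  rw [approxRatio]
  split_ifs with hzero
  · have hmed : socialCost (coordMedian hn x) x ≤ 0 := by
      simpa [hzero] using socialCost_coordMedian_le hn x (geomMedian hn x)
    exact (div_nonpos_of_nonpos_of_nonneg hmed (socialCost_nonneg _ _)).trans zero_le_one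
  · exact div_le_div_of_nonneg_left (socialCost_nonneg _ _)
      ((socialCost_nonneg _ _).lt_of_ne' hzero) (geomMedian_spec hn x y)

theorem sum_isoscelesProfile {M : Type*} [AddCommMonoid M] (f : Plane → M) (m : ℕ) (t : ℝ) :
    ∑ i, f (isoscelesProfile (2 * m + 1) m t i) =
      m • f !₂[t, 0] + f !₂[-t, 0] + m • f !₂[0, 1] := by
  unfold isoscelesProfile
  rw [Fin.sum_univ_eq_sum_range (fun i => f (if i < m then !₂[t, 0] else
    if i = m then !₂[-t, 0] else !₂[0, 1])), show 2 * m + 1 = m + 1 + m by ring,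
    Finset.sum_range_add, Finset.sum_range_succ]
  congr 1
  · congr 1
    · rw [Finset.sum_congr rfl fun i hi => by rw [if_pos (Finset.mem_range.1 hi)]]
      simp
    · simp
  · simp [add_assoc, add_comm 1]

theorem card_isoscelesProfile (P : Plane → Prop) [DecidablePred P] (m : ℕ) (t : ℝ) :
    #{i | P (isoscelesProfile (2 * m + 1) m t i)} =
      (if P !₂[t, 0] then m else 0) + (if P !₂[-t, 0] then 1 else 0) +
        (if P !₂[0, 1] then m else 0) := by
  simp [Finset.card_filter, sum_isoscelesProfile (fun p => if P p then 1 else 0)]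

theorem coordMedian_isoscelesProfile {m : ℕ} (hm : 1 ≤ m) (hn : Odd (2 * m + 1)) {t : ℝ}
    (ht : 0 ≤ t) : coordMedian hn (isoscelesProfile (2 * m + 1) m t) = 0 := by
  ext j
  rw [coordMedian_apply]
  apply oddMedian_eq
  · rw [card_isoscelesProfile (fun p => p j ≤ (0 : Plane) j)]
    fin_cases j <;> simp [ht] <;> omega
  · rw [card_isoscelesProfile (fun p => (0 : Plane) j ≤ p j)]
    fin_cases j <;> simp [ht] <;> omega

theorem socialCost_isoscelesProfile (m : ℕ) (t : ℝ) (y : Plane) :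
    socialCost y (isoscelesProfile (2 * m + 1) m t) =
      m * ‖y - !₂[t, 0]‖ + ‖y - !₂[-t, 0]‖ + m * ‖y - !₂[0, 1]‖ := by
  simpa only [socialCost, nsmul_eq_mul] using sum_isoscelesProfile (fun p => ‖y - p‖) m t

theorem socialCost_zero_isoscelesProfile (m : ℕ) {t : ℝ} (ht : 0 ≤ t) :
    socialCost 0 (isoscelesProfile (2 * m + 1) m t) = ((m : ℝ) + 1) * t + m := by
  simp [socialCost_isoscelesProfile, EuclideanSpace.norm_eq, Real.sqrt_sq ht]
  ring

theorem socialCost_apex_isoscelesProfile (m : ℕ) (t : ℝ) :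
    socialCost !₂[0, 1] (isoscelesProfile (2 * m + 1) m t) = ((m : ℝ) + 1) * √(1 + t ^ 2) := by
  simp [socialCost_isoscelesProfile, EuclideanSpace.norm_eq, add_comm (t ^ 2)]
  ring

theorem approxRatio_isoscelesProfile {m : ℕ} (hm : 1 ≤ m) (hn : Odd (2 * m + 1)) :
    approxRatio hn (isoscelesProfile (2 * m + 1) m (((m : ℝ) + 1) / m)) =
      √(1 + majorityWeight (2 * m + 1) ^ 2) := by
  refine le_antisymm (approxRatio_le hn _) ?_
  have hm0 : (0 : ℝ) < m := by exact_mod_cast hm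
  set t : ℝ := ((m : ℝ) + 1) / m with ht
  have ht0 : 0 < t := div_pos (by positivity) hm0
  have hmt : (m : ℝ) + 1 = m * t := by rw [ht]; field_simp
  have hweight : majorityWeight (2 * m + 1) = t⁻¹ := by
    rw [majorityWeight_two_mul_add_one, ht, inv_div]
  refine le_of_eq_of_le ?_ (div_socialCost_le_approxRatio hn _ !₂[0, 1])
  rw [coordMedian_isoscelesProfile hm hn ht0.le, socialCost_zero_isoscelesProfile m ht0.le,
    socialCost_apex_isoscelesProfile, hweight]
  calc √(1 + t⁻¹ ^ 2) = √(1 + t ^ 2) / t := by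
        rw [eq_div_iff ht0.ne', ← Real.sqrt_sq ht0.le, ← Real.sqrt_mul (by positivity),
          Real.sqrt_sq ht0.le]
        congr 1
        field_simp
        ring
    _ = m * √(1 + t ^ 2) ^ 2 / (m * t * √(1 + t ^ 2)) := by field_simp
    _ = ((m + 1) * t + m) / ((m + 1) * √(1 + t ^ 2)) := by
        rw [Real.sq_sqrt (by positivity), hmt]
        ring

theorem exists_approxRatio_eq (hn : Odd n) :
    ∃ x : Fin n → Plane, approxRatio hn x = √(1 + majorityWeight n ^ 2) := by
  obtain ⟨m, rfl⟩ := id hn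
  rcases m.eq_zero_or_pos with rfl | hm
  · refine ⟨0, (approxRatio_le hn 0).antisymm ?_⟩
    simpa [majorityWeight] using one_le_approxRatio hn 0
  · exact ⟨_, approxRatio_isoscelesProfile hm hn⟩

end LowerBound

theorem mainTheorem1 (n : ℕ) (hn : Odd n) :
    IsLUB (Set.range (fun x : Fin n → Plane => approxRatio hn x))
      (√2 * (√((n : ℝ) ^ 2 + 1) / ((n : ℝ) + 1))) ∧
    ∀ m : ℕ, 1 ≤ m → n = 2 * m + 1 →
      approxRatio hn (isoscelesProfile n m (((m : ℝ) + 1) / (m : ℝ))) =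
        √2 * (√((n : ℝ) ^ 2 + 1) / ((n : ℝ) + 1)) := by
  rw [← sqrt_one_add_majorityWeight_sq]
  refine ⟨IsGreatest.isLUB ⟨exists_approxRatio_eq hn, ?_⟩, ?_⟩
  · rintro _ ⟨x, rfl⟩
    exact approxRatio_le hn x
  · rintro m hm rfl
    exact approxRatio_isoscelesProfile hm hn
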